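/- All vector lattices are real and Archimedean ($nx\le y$ for all $n\in\mathbb N$ implies $x\le 0$). A locally convex-solid vector lattice is a vector lattice with a (not necessarily Hausdorff) linear topology having a base of neighbourhoods of zero consisting of convex solid sets. A bilinear map $\Phi:E\times F\to G$ between vector lattices is a lattice bimorphism if $\Phi(x,\cdot)$ and $\Phi(\cdot,y)$ are lattice homomorphisms for all $x\in E_+$, $y\in F_+$. Let $(E,\tau_1)$ and $(F,\tau_2)$ be Archimedean locally convex-solid vector lattices, and let $\otimes:E\times F\to E\overline{\otimes}F$ be their Fremlin tensor product, i.e. the Archimedean vector lattice generated by the elements $x\otimes y$ ($x\in E$, $y\in F$) subject to the relations saying that $(x,y)\mapsto x\otimes y$ is a lattice bimorphism. Equip $E\overline{\otimes}F$ with the linear topology $\tau_F$ for which the sets $$\mathrm{Conv}_b(\mathrm{Sol}(U\otimes V)),\qquad U\otimes V=\{x\otimes y: x\in U,\ y\in V\},$$ form a base of neighbourhoods of zero, where $U\subseteq E$ and $V\subseteq F$ range over the convex solid neighbourhoods of zero, $\mathrm{Sol}(A)=\{z: |z|\le|a|\text{ for some }a\in A\}$ is the solid hull and $\mathrm{Conv}_b$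 denotes the convex balanced hull. Then, for each Archimedean locally convex-solid vector lattice $G$ and each (jointly) continuous lattice bimorphism $\Phi:E\times F\to G$, there exists a unique continuous lattice homomorphism $T:(E\overline{\otimes}F,\tau_F)\to G$ such that $\Phi(x,y)=T(x\otimes y)$ for all $x\in E$ and $y\in F$. -/

import Mathlib

open Set Filter Topology Pointwise

universe u v w

/-! ### Vector lattices

A (real) vector lattice is a real vector space `E` with a lattice order compatible with the
vector space structure:
`[AddCommGroup E] [Module ℝ E] [Lattice E] [IsOrderedAddMonoid E] [IsOrderedModule ℝ E]`. -/

/-- A vector lattice is Archimedean if `n x ≤ y` for all natural numbers `n` forces `x ≤ 0`. -/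
def IsArchimedeanLattice (E : Type u) [AddCommGroup E] [Lattice E] : Prop :=
  ∀ x y : E, (∀ n : ℕ, n • x ≤ y) → x ≤ 0

/-- A linear map between vector lattices is a lattice homomorphism if it preserves finite suprema
and infima. -/
structure IsLatticeHom {E : Type u} {F : Type v} [AddCommGroup E] [Module ℝ E] [Lattice E]
    [AddCommGroup F] [Module ℝ F] [Lattice F] (T : E →ₗ[ℝ] F) : Prop where
  map_sup : ∀ a b : E, T (a ⊔ b) = T a ⊔ T b
  map_inf : ∀ a b : E, T (a ⊓ b) = T a ⊓ T b

/-- A bilinear map `Φ : E × F → G` is a lattice bimorphism if `Φ(x, ·)` and `Φ(·, y)` are lattice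
homomorphisms for all `x ≥ 0` in `E` and `y ≥ 0` in `F`. -/
structure IsLatticeBimorphism {E : Type u} {F : Type v} {G : Type w}
    [AddCommGroup E] [Module ℝ E] [Lattice E] [AddCommGroup F] [Module ℝ F] [Lattice F]
    [AddCommGroup G] [Module ℝ G] [Lattice G] (Φ : E →ₗ[ℝ] F →ₗ[ℝ] G) : Prop where
  left : ∀ x : E, 0 ≤ x → IsLatticeHom (Φ x)
  right : ∀ y : F, 0 ≤ y → IsLatticeHom (Φ.flip y)

/-- A locally convex-solid vector lattice: a vector lattice with a linear topology for which the
convex solid neighbourhoods of zero form a base of the neighbourhoods of zero.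
(The topology need not be Hausdorff.) -/
class LocallyConvexSolid (E : Type u) [AddCommGroup E] [Module ℝ E] [Lattice E]
    [IsOrderedAddMonoid E] [IsOrderedModule ℝ E] [TopologicalSpace E] : Prop
    extends IsTopologicalAddGroup E, ContinuousSMul ℝ E where
  exists_convex_solid : ∀ s ∈ 𝓝 (0 : E), ∃ U ∈ 𝓝 (0 : E),
    Convex ℝ U ∧ LatticeOrderedAddCommGroup.IsSolid U ∧ U ⊆ s

/-! ### The Fremlin tensor product

It is constructed as the Archimedean vector lattice presented by generators `x ⊗ y`
(`x ∈ E`, `y ∈ F`) and the relations saying that `(x, y) ↦ x ⊗ y` is a lattice bimorphism.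
So it is Archimedean, it is generated by the elements `x ⊗ y` as a vector lattice, and it is
initial among Archimedean vector lattices with a lattice bimorphism from `E × F`; these
properties determine the Fremlin tensor product up to a unique isomorphism. -/

/-- Formal vector lattice expressions in the symbols `x ⊗ y`. -/
inductive FremlinTerm (E : Type u) (F : Type v) : Type (max u v)
  | tmul (x : E) (y : F) : FremlinTerm E F
  | zero : FremlinTerm E F
  | add (a b : FremlinTerm E F) : FremlinTerm E F
  | smul (r : ℝ) (a : FremlinTerm E F) : FremlinTerm E F
  | sup (a b : FremlinTerm E F) : FremlinTerm E F

/-- The smallest congruence on expressions whose quotient is an Archimedean vector lattice in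
which `x ⊗ y` is a lattice bimorphism of `(x, y)`. Here `a ≤ b` is expressed as `a ⊔ b = b`. -/
inductive FremlinRel (E : Type u) (F : Type v) [AddCommGroup E] [Module ℝ E] [Lattice E]
    [AddCommGroup F] [Module ℝ F] [Lattice F] : FremlinTerm E F → FremlinTerm E F → Prop
  -- equivalence relation and congruence
  | refl (a) : FremlinRel E F a a
  | symm {a b} : FremlinRel E F a b → FremlinRel E F b a
  | trans {a b c} : FremlinRel E F a b → FremlinRel E F b c → FremlinRel E F a c
  | add_congr {a a' b b'} : FremlinRel E F a a' → FremlinRel E F b b' →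
      FremlinRel E F (.add a b) (.add a' b')
  | smul_congr (r) {a a'} : FremlinRel E F a a' → FremlinRel E F (.smul r a) (.smul r a')
  | sup_congr {a a' b b'} : FremlinRel E F a a' → FremlinRel E F b b' →
      FremlinRel E F (.sup a b) (.sup a' b')
  -- real vector space
  | add_comm (a b) : FremlinRel E F (.add a b) (.add b a)
  | add_assoc (a b c) : FremlinRel E F (.add (.add a b) c) (.add a (.add b c))
  | zero_add (a) : FremlinRel E F (.add .zero a) a
  | smul_add (r a b) : FremlinRel E F (.smul r (.add a b)) (.add (.smul r a) (.smul r b))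
  | add_smul (r s a) : FremlinRel E F (.smul (r + s) a) (.add (.smul r a) (.smul s a))
  | mul_smul (r s a) : FremlinRel E F (.smul (r * s) a) (.smul r (.smul s a))
  | one_smul (a) : FremlinRel E F (.smul 1 a) a
  | zero_smul (a) : FremlinRel E F (.smul 0 a) .zero
  -- compatible lattice order
  | sup_comm (a b) : FremlinRel E F (.sup a b) (.sup b a)
  | sup_assoc (a b c) : FremlinRel E F (.sup (.sup a b) c) (.sup a (.sup b c))
  | sup_idem (a) : FremlinRel E F (.sup a a) a
  | sup_add (a b c) : FremlinRel E F (.add (.sup a b) c) (.sup (.add a c) (.add b c))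
  | smul_sup (r a b) : 0 ≤ r → FremlinRel E F (.smul r (.sup a b)) (.sup (.smul r a) (.smul r b))
  -- Archimedean property
  | archimedean (a b) : (∀ n : ℕ, FremlinRel E F (.sup (.smul (n : ℝ) a) b) b) →
      FremlinRel E F (.sup a .zero) .zero
  -- the generators form a lattice bimorphism
  | add_tmul (x x' y) : FremlinRel E F (.tmul (x + x') y) (.add (.tmul x y) (.tmul x' y))
  | tmul_add (x y y') : FremlinRel E F (.tmul x (y + y')) (.add (.tmul x y) (.tmul x y'))
  | smul_tmul (r x y) : FremlinRel E F (.tmul (r • x) y) (.smul r (.tmul x y))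
  | tmul_smul (r x y) : FremlinRel E F (.tmul x (r • y)) (.smul r (.tmul x y))
  | sup_tmul (x x' y) : 0 ≤ y →
      FremlinRel E F (.tmul (x ⊔ x') y) (.sup (.tmul x y) (.tmul x' y))
  | tmul_sup (x y y') : 0 ≤ x →
      FremlinRel E F (.tmul x (y ⊔ y')) (.sup (.tmul x y) (.tmul x y'))

section Fremlin

variable (E : Type u) (F : Type v) [AddCommGroup E] [Module ℝ E] [Lattice E]
  [AddCommGroup F] [Module ℝ F] [Lattice F]

/-- The congruence `FremlinRel` as a setoid. -/
def fremlinSetoid : Setoid (FremlinTerm E F) where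
  r := FremlinRel E F
  iseqv := ⟨.refl, .symm, .trans⟩

/-- The Fremlin tensor product of the vector lattices `E` and `F`. -/
def FremlinTensorProduct : Type (max u v) := Quotient (fremlinSetoid E F)

namespace FremlinTensorProduct

variable {E F}

/-- The class of an expression. -/
def mk (a : FremlinTerm E F) : FremlinTensorProduct E F := Quotient.mk (fremlinSetoid E F) a

theorem ind {p : FremlinTensorProduct E F → Prop} (h : ∀ a, p (mk a)) (z) : p z :=
  Quotient.ind h z

theorem sound {a b : FremlinTerm E F} (h : FremlinRel E F a b) : mk a = mk b :=
  Quotient.sound (s := fremlinSetoid E F) h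

theorem exact {a b : FremlinTerm E F} (h : mk a = mk b) : FremlinRel E F a b :=
  Quotient.exact (s := fremlinSetoid E F) h

instance : Zero (FremlinTensorProduct E F) := ⟨mk .zero⟩

instance : Add (FremlinTensorProduct E F) :=
  ⟨Quotient.map₂ .add fun _ _ h _ _ h' => .add_congr h h'⟩

instance : SMul ℝ (FremlinTensorProduct E F) :=
  ⟨fun r => Quotient.map (.smul r) fun _ _ h => .smul_congr r h⟩

/-- The binary supremum. -/
def sup : FremlinTensorProduct E F → FremlinTensorProduct E F → FremlinTensorProduct E F :=
  Quotient.map₂ .sup fun _ _ h _ _ h' => .sup_congr h h'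

theorem mk_zero : mk (.zero : FremlinTerm E F) = 0 := rfl
theorem mk_add (a b : FremlinTerm E F) : mk (.add a b) = mk a + mk b := rfl
theorem mk_smul (r : ℝ) (a : FremlinTerm E F) : mk (.smul r a) = r • mk a := rfl

instance : Neg (FremlinTensorProduct E F) := ⟨fun a => (-1 : ℝ) • a⟩

instance : AddCommGroup (FremlinTensorProduct E F) where
  add_assoc a b c := by
    induction a using ind; induction b using ind; induction c using ind
    exact sound (.add_assoc _ _ _)
  add_comm a b := by
    induction a using ind; induction b using ind
    exact sound (.add_comm _ _)
  zero_add a := by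
    induction a using ind
    exact sound (.zero_add _)
  add_zero a := by
    induction a using ind
    exact sound (.trans (.add_comm _ _) (.zero_add _))
  nsmul := nsmulRec
  zsmul := zsmulRec
  neg_add_cancel a := by
    induction a using ind with | _ a
    refine sound (.trans (.add_congr (.refl _) (.symm (.one_smul a))) ?_)
    refine .trans (.symm (.add_smul (-1) 1 a)) ?_
    rw [neg_add_cancel]
    exact .zero_smul a

instance : Module ℝ (FremlinTensorProduct E F) where
  one_smul a := by
    induction a using ind
    exact sound (.one_smul _)
  mul_smul r s a := by
    induction a using ind
    exact sound (.mul_smul _ _ _)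
  smul_add r a b := by
    induction a using ind; induction b using ind
    exact sound (.smul_add _ _ _)
  add_smul r s a := by
    induction a using ind
    exact sound (.add_smul _ _ _)
  zero_smul a := by
    induction a using ind
    exact sound (.zero_smul _)
  smul_zero r := by
    have h : (0 : FremlinTensorProduct E F) = (0 : ℝ) • (0 : FremlinTensorProduct E F) :=
      (sound (.zero_smul _)).symm
    have h' : r • ((0 : ℝ) • (0 : FremlinTensorProduct E F))
        = (r * 0) • (0 : FremlinTensorProduct E F) := (sound (.mul_smul _ _ _)).symm
    rw [h, h', mul_zero]

theorem sup_comm' (a b : FremlinTensorProduct E F) : sup a b = sup b a := by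
  induction a using ind; induction b using ind
  exact sound (.sup_comm _ _)

theorem sup_assoc' (a b c : FremlinTensorProduct E F) : sup (sup a b) c = sup a (sup b c) := by
  induction a using ind; induction b using ind; induction c using ind
  exact sound (.sup_assoc _ _ _)

theorem sup_idem' (a : FremlinTensorProduct E F) : sup a a = a := by
  induction a using ind
  exact sound (.sup_idem _)

instance : PartialOrder (FremlinTensorProduct E F) where
  le a b := sup a b = b
  le_refl a := sup_idem' a
  le_trans a b c h h' := by
    change sup a c = c
    rw [← h', ← sup_assoc', h]
  le_antisymm a b h h' := by
    rw [← h, sup_comm']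
    exact h'.symm

theorem le_def (a b : FremlinTensorProduct E F) : a ≤ b ↔ sup a b = b := Iff.rfl

instance : IsOrderedAddMonoid (FremlinTensorProduct E F) where
  add_le_add_left a b h c := by
    rw [le_def] at h ⊢
    have h' : sup a b + c = sup (a + c) (b + c) := by
      induction a using ind; induction b using ind; induction c using ind
      exact sound (.sup_add _ _ _)
    rw [← h', h]

instance : SemilatticeSup (FremlinTensorProduct E F) where
  sup := sup
  le_sup_left a b := by rw [le_def, ← sup_assoc', sup_idem']
  le_sup_right a b := by rw [le_def, sup_comm' a b, ← sup_assoc', sup_idem']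
  sup_le a b c h h' := by
    rw [le_def] at h h' ⊢
    rw [sup_assoc', h', h]

instance : Lattice (FremlinTensorProduct E F) where
  inf a b := -(-a ⊔ -b)
  inf_le_left a b := neg_le.mp le_sup_left
  inf_le_right a b := neg_le.mp le_sup_right
  le_inf a b c h h' := le_neg.mp (sup_le (neg_le_neg h) (neg_le_neg h'))

theorem mk_sup (a b : FremlinTerm E F) : mk (.sup a b) = mk a ⊔ mk b := rfl

theorem smul_mono' (r : ℝ) (hr : 0 ≤ r) {a b : FremlinTensorProduct E F} (h : a ≤ b) :
    r • a ≤ r • b := by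
  rw [← sup_eq_right] at h ⊢
  have h' : r • (a ⊔ b) = r • a ⊔ r • b := by
    induction a using ind; induction b using ind
    exact sound (.smul_sup _ _ _ hr)
  rw [← h', h]

instance : IsOrderedModule ℝ (FremlinTensorProduct E F) where
  smul_le_smul_of_nonneg_left r hr _ _ h := smul_mono' r hr h
  smul_le_smul_of_nonneg_right a ha r s h := by
    have := smul_mono' (s - r) (sub_nonneg.mpr h) ha
    rwa [smul_zero, sub_smul, sub_nonneg] at this

theorem isArchimedeanLattice : IsArchimedeanLattice (FremlinTensorProduct E F) := by
  intro a b h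
  induction a using ind with | _ a
  induction b using ind with | _ b
  rw [← sup_eq_right]
  refine sound (.archimedean a b fun n => exact ?_)
  rw [mk_sup, mk_smul, Nat.cast_smul_eq_nsmul, sup_eq_right]
  exact h n

variable (E F) in
/-- The canonical bilinear map `⊗ : E × F → E ⊗̄ F`. -/
def tmul : E →ₗ[ℝ] F →ₗ[ℝ] FremlinTensorProduct E F :=
  LinearMap.mk₂ ℝ (fun x y => mk (.tmul x y))
    (fun _ _ _ => sound (.add_tmul _ _ _)) (fun _ _ _ => sound (.smul_tmul _ _ _))
    (fun _ _ _ => sound (.tmul_add _ _ _)) (fun _ _ _ => sound (.tmul_smul _ _ _))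

theorem mk_tmul (x : E) (y : F) : mk (.tmul x y) = tmul E F x y := rfl

end FremlinTensorProduct

end Fremlin

/-! ### The topology `τ_F` on the Fremlin tensor product -/

section Topology

variable {E : Type u} {F : Type v} [AddCommGroup E] [Module ℝ E] [Lattice E]
  [IsOrderedAddMonoid E] [IsOrderedModule ℝ E]
  [AddCommGroup F] [Module ℝ F] [Lattice F] [IsOrderedAddMonoid F] [IsOrderedModule ℝ F]

/-- A linear map preserving suprema preserves infima. -/
theorem isLatticeHom_of_map_sup {T : E →ₗ[ℝ] F} (h : ∀ a b, T (a ⊔ b) = T a ⊔ T b) :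
    IsLatticeHom T where
  map_sup := h
  map_inf a b := by
    have := h (-a) (-b)
    rw [← neg_inf, map_neg, map_neg, map_neg, ← neg_inf] at this
    exact neg_injective this

theorem abs_real_smul (r : ℝ) (a : E) : |r • a| = |r| • |a| := by
  have key : ∀ (s : ℝ), 0 ≤ s → |s • a| = s • |a| := by
    intro s hs
    rcases hs.eq_or_lt with rfl | hs
    · simp
    · refine le_antisymm (abs_le'.mpr ⟨?_, ?_⟩) ?_
      · exact smul_le_smul_of_nonneg_left (le_abs_self a) hs.le
      · rw [← smul_neg]
        exact smul_le_smul_of_nonneg_left (neg_le_abs a) hs.le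
      · have : |a| ≤ s⁻¹ • |s • a| := by
          refine abs_le'.mpr ⟨?_, ?_⟩
          · have := smul_le_smul_of_nonneg_left (le_abs_self (s • a)) (inv_pos.mpr hs).le
            rwa [inv_smul_smul₀ hs.ne'] at this
          · have := smul_le_smul_of_nonneg_left (neg_le_abs (s • a)) (inv_pos.mpr hs).le
            rwa [smul_neg, inv_smul_smul₀ hs.ne'] at this
        have := smul_le_smul_of_nonneg_left this hs.le
        rwa [smul_inv_smul₀ hs.ne'] at this
  rcases le_total 0 r with hr | hr
  · rw [abs_of_nonneg hr, key r hr]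
  · rw [abs_of_nonpos hr, ← key (-r) (neg_nonneg.mpr hr), neg_smul, abs_neg]

namespace FremlinTensorProduct

theorem isLatticeBimorphism_tmul : IsLatticeBimorphism (tmul E F) where
  left x hx := isLatticeHom_of_map_sup fun _ _ => sound (.tmul_sup _ _ _ hx)
  right y hy := isLatticeHom_of_map_sup fun _ _ => sound (.sup_tmul _ _ _ hy)

theorem tmul_nonneg {x : E} {y : F} (hx : 0 ≤ x) (hy : 0 ≤ y) : 0 ≤ tmul E F x y := by
  have h := (isLatticeBimorphism_tmul.left x hx).map_sup 0 y
  rw [sup_eq_right.mpr hy, map_zero] at h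
  exact sup_eq_right.mp h.symm

theorem abs_tmul_le (x : E) (y : F) : |tmul E F x y| ≤ tmul E F |x| |y| := by
  have hp := posPart_nonneg x
  have hn := negPart_nonneg x
  have hx := posPart_add_negPart x
  have hxx := posPart_sub_negPart x
  have hp' := posPart_nonneg y
  have hn' := negPart_nonneg y
  have e1 : tmul E F |x| |y| - tmul E F x y
      = (2 : ℕ) • (tmul E F x⁺ y⁻ + tmul E F x⁻ y⁺) := by
    conv_lhs => rw [← hx, ← posPart_add_negPart y]
    conv_lhs => enter [2]; rw [← hxx, ← posPart_sub_negPart y]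
    simp only [map_sub, LinearMap.sub_apply, map_add, LinearMap.add_apply]
    abel
  have e2 : tmul E F |x| |y| + tmul E F x y
      = (2 : ℕ) • (tmul E F x⁺ y⁺ + tmul E F x⁻ y⁻) := by
    conv_lhs => rw [← hx, ← posPart_add_negPart y]
    conv_lhs => enter [2]; rw [← hxx, ← posPart_sub_negPart y]
    simp only [map_sub, LinearMap.sub_apply, map_add, LinearMap.add_apply]
    abel
  refine abs_le'.mpr ⟨?_, ?_⟩
  · rw [← sub_nonneg, e1]
    exact nsmul_nonneg (add_nonneg (tmul_nonneg hp hn') (tmul_nonneg hn hp')) 2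
  · rw [← sub_nonneg, sub_neg_eq_add, e2]
    exact nsmul_nonneg (add_nonneg (tmul_nonneg hp hp') (tmul_nonneg hn hn')) 2

/-- Every element is dominated by an elementary tensor. -/
theorem exists_abs_le_tmul (z : FremlinTensorProduct E F) :
    ∃ a : E, ∃ b : F, 0 ≤ a ∧ 0 ≤ b ∧ |z| ≤ tmul E F a b := by
  have add_case : ∀ z₁ z₂ z : FremlinTensorProduct E F, |z| ≤ |z₁| + |z₂| →
      (∃ a : E, ∃ b : F, 0 ≤ a ∧ 0 ≤ b ∧ |z₁| ≤ tmul E F a b) →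
      (∃ a : E, ∃ b : F, 0 ≤ a ∧ 0 ≤ b ∧ |z₂| ≤ tmul E F a b) →
      ∃ a : E, ∃ b : F, 0 ≤ a ∧ 0 ≤ b ∧ |z| ≤ tmul E F a b := by
    rintro z₁ z₂ z hz ⟨a, b, ha, hb, h⟩ ⟨a', b', ha', hb', h'⟩
    refine ⟨a + a', b + b', add_nonneg ha ha', add_nonneg hb hb', hz.trans ?_⟩
    refine (add_le_add h h').trans ?_
    rw [← sub_nonneg]
    have : tmul E F (a + a') (b + b') - (tmul E F a b + tmul E F a' b')
        = tmul E F a b' + tmul E F a' b := by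
      simp only [map_add, LinearMap.add_apply]
      abel
    rw [this]
    exact add_nonneg (tmul_nonneg ha hb') (tmul_nonneg ha' hb)
  induction z using ind with | _ t
  induction t with
  | tmul x y => exact ⟨|x|, |y|, abs_nonneg x, abs_nonneg y, abs_tmul_le x y⟩
  | zero => exact ⟨0, 0, le_rfl, le_rfl, by simp [mk_zero]⟩
  | add s t hs ht => exact add_case _ _ _ (by rw [mk_add]; exact abs_add_le _ _) hs ht
  | smul r s hs =>
    obtain ⟨a, b, ha, hb, h⟩ := hs
    refine ⟨|r| • a, b, smul_nonneg (abs_nonneg r) ha, hb, ?_⟩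
    rw [mk_smul, abs_real_smul, map_smul, LinearMap.smul_apply]
    exact smul_le_smul_of_nonneg_left h (abs_nonneg r)
  | sup s t hs ht =>
    refine add_case _ _ _ ?_ hs ht
    have h₁ : |mk s| ≤ |mk s| + |mk t| := le_add_of_nonneg_right (abs_nonneg _)
    have h₂ : |mk t| ≤ |mk s| + |mk t| := le_add_of_nonneg_left (abs_nonneg _)
    rw [mk_sup]
    refine abs_le'.mpr ⟨sup_le ((le_abs_self _).trans h₁) ((le_abs_self _).trans h₂), ?_⟩
    exact (neg_le_neg le_sup_left).trans ((neg_le_abs _).trans h₁)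

/-- The set `Conv_b (Sol (U ⊗ V))`, where `U ⊗ V = {x ⊗ y : x ∈ U, y ∈ V}`, `Sol` is the solid
hull and `Conv_b` the absolutely convex (that is, convex balanced) hull. -/
def nhdSet (U : Set E) (V : Set F) : Set (FremlinTensorProduct E F) :=
  absConvexHull ℝ (LatticeOrderedAddCommGroup.solidClosure
    (image2 (fun x y => tmul E F x y) U V))

theorem nhdSet_mono {U U' : Set E} {V V' : Set F} (hU : U ⊆ U') (hV : V ⊆ V') :
    nhdSet U V ⊆ nhdSet U' V' := by
  refine absConvexHull_mono ?_
  rintro z ⟨_, ⟨x, hx, y, hy, rfl⟩, h⟩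
  exact ⟨_, ⟨x, hU hx, y, hV hy, rfl⟩, h⟩

theorem mem_nhdSet {U : Set E} {V : Set F} {x : E} {y : F} (hx : x ∈ U) (hy : y ∈ V)
    {z : FremlinTensorProduct E F} (h : |z| ≤ |tmul E F x y|) : z ∈ nhdSet U V :=
  subset_absConvexHull ⟨_, ⟨x, hx, y, hy, rfl⟩, h⟩

theorem smul_nhdSet_subset (r : ℝ) (U : Set E) (V : Set F) {z : FremlinTensorProduct E F}
    (hz : z ∈ nhdSet ((fun x => r • x) ⁻¹' U) V) : r • z ∈ nhdSet U V := by
  have hconv : AbsConvex ℝ ((fun z : FremlinTensorProduct E F => r • z) ⁻¹' nhdSet U V) := by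
    refine ⟨?_, ?_⟩
    · intro a ha
      rintro _ ⟨w, hw, rfl⟩
      have := (balanced_absConvexHull (𝕜 := ℝ)).smul_mem ha hw
      change r • (a • w) ∈ nhdSet U V
      rw [smul_comm]
      exact this
    · exact convex_absConvexHull.is_linear_preimage (IsLinearMap.isLinearMap_smul r)
  refine absConvexHull_min ?_ hconv hz
  rintro w ⟨_, ⟨x, hx, y, hy, rfl⟩, h⟩
  refine mem_nhdSet (x := r • x) hx hy ?_
  rw [abs_real_smul, map_smul, LinearMap.smul_apply, abs_real_smul]
  exact smul_le_smul_of_nonneg_left h (abs_nonneg r)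

variable (E F)
variable [TopologicalSpace E] [LocallyConvexSolid E] [TopologicalSpace F] [LocallyConvexSolid F]

/-- The sets `Conv_b (Sol (U ⊗ V))`, for `U` and `V` convex solid neighbourhoods of zero in `E`
and `F`, form a base of neighbourhoods of zero for a linear topology. -/
def filterBasis : ModuleFilterBasis ℝ (FremlinTensorProduct E F) where
  sets := {W | ∃ U ∈ 𝓝 (0 : E), ∃ V ∈ 𝓝 (0 : F),
    Convex ℝ U ∧ LatticeOrderedAddCommGroup.IsSolid U ∧
    Convex ℝ V ∧ LatticeOrderedAddCommGroup.IsSolid V ∧ W = nhdSet U V}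
  nonempty := ⟨_, univ, univ_mem, univ, univ_mem, convex_univ, fun _ _ _ _ => mem_univ _,
    convex_univ, fun _ _ _ _ => mem_univ _, rfl⟩
  inter_sets := by
    rintro _ _ ⟨U, hU, V, hV, cU, sU, cV, sV, rfl⟩ ⟨U', hU', V', hV', cU', sU', cV', sV', rfl⟩
    refine ⟨_, ⟨U ∩ U', inter_mem hU hU', V ∩ V', inter_mem hV hV', cU.inter cU', ?_,
      cV.inter cV', ?_, rfl⟩, subset_inter
        (nhdSet_mono inter_subset_left inter_subset_left)
        (nhdSet_mono inter_subset_right inter_subset_right)⟩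
    · exact fun x hx y hy => ⟨sU hx.1 hy, sU' hx.2 hy⟩
    · exact fun x hx y hy => ⟨sV hx.1 hy, sV' hx.2 hy⟩
  zero' := by
    rintro _ ⟨U, hU, V, hV, -, -, -, -, rfl⟩
    exact mem_nhdSet (mem_of_mem_nhds hU) (mem_of_mem_nhds hV) (by simp)
  add' := by
    rintro _ ⟨U, hU, V, hV, cU, sU, cV, sV, rfl⟩
    have hU2 : (fun x : E => (2 : ℝ) • x) ⁻¹' U ∈ 𝓝 (0 : E) :=
      (continuous_const_smul (2 : ℝ)).continuousAt.preimage_mem_nhds (by simpa using hU)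
    obtain ⟨U', hU', cU', sU', hsub⟩ := LocallyConvexSolid.exists_convex_solid _ hU2
    refine ⟨_, ⟨U', hU', V, hV, cU', sU', cV, sV, rfl⟩, ?_⟩
    rintro _ ⟨a, ha, b, hb, rfl⟩
    have ha' := smul_nhdSet_subset 2 U V (nhdSet_mono hsub subset_rfl ha)
    have hb' := smul_nhdSet_subset 2 U V (nhdSet_mono hsub subset_rfl hb)
    have := convex_absConvexHull (𝕜 := ℝ) ha' hb' (a := 1 / 2) (b := 1 / 2)
      (by norm_num) (by norm_num) (by norm_num)
    simpa [smul_smul, nhdSet] using this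
  neg' := by
    rintro _ ⟨U, hU, V, hV, h⟩
    refine ⟨_, ⟨U, hU, V, hV, h⟩, ?_⟩
    obtain ⟨-, -, -, -, rfl⟩ := h
    intro z hz
    have := (balanced_absConvexHull (𝕜 := ℝ)).smul_mem (a := -1) (by simp) hz
    simpa [nhdSet] using this
  conj' := by
    rintro z _ ⟨U, hU, V, hV, h⟩
    refine ⟨_, ⟨U, hU, V, hV, h⟩, ?_⟩
    intro x hx
    simpa using hx
  smul' := by
    rintro _ ⟨U, hU, V, hV, h⟩
    refine ⟨Metric.closedBall 0 1, Metric.closedBall_mem_nhds 0 one_pos, _,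
      ⟨U, hU, V, hV, h⟩, ?_⟩
    obtain ⟨-, -, -, -, rfl⟩ := h
    rintro _ ⟨r, hr, z, hz, rfl⟩
    exact (balanced_absConvexHull (𝕜 := ℝ)).smul_mem (mem_closedBall_zero_iff.mp hr) hz
  smul_left' := by
    rintro r _ ⟨U, hU, V, hV, cU, sU, cV, sV, rfl⟩
    have hUr : (fun x : E => r • x) ⁻¹' U ∈ 𝓝 (0 : E) :=
      (continuous_const_smul r).continuousAt.preimage_mem_nhds (by simpa using hU)
    obtain ⟨U', hU', cU', sU', hsub⟩ := LocallyConvexSolid.exists_convex_solid _ hUr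
    exact ⟨_, ⟨U', hU', V, hV, cU', sU', cV, sV, rfl⟩,
      fun z hz => smul_nhdSet_subset r U V (nhdSet_mono hsub subset_rfl hz)⟩
  smul_right' := by
    rintro z _ ⟨U, hU, V, hV, -, -, -, -, rfl⟩
    obtain ⟨a, b, ha, hb, hz⟩ := exists_abs_le_tmul z
    have hc : Continuous fun r : ℝ => √|r| := continuous_abs.sqrt
    have h₁ : ∀ᶠ r : ℝ in 𝓝 0, √|r| • a ∈ U :=
      (hc.smul (continuous_const (y := a))).continuousAt.preimage_mem_nhds (by simpa using hU)
    have h₂ : ∀ᶠ r : ℝ in 𝓝 0, √|r| • b ∈ V :=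
      (hc.smul (continuous_const (y := b))).continuousAt.preimage_mem_nhds (by simpa using hV)
    filter_upwards [h₁, h₂] with r h₁ h₂
    refine mem_nhdSet h₁ h₂ ?_
    rw [map_smul, map_smul, LinearMap.smul_apply, smul_smul, Real.mul_self_sqrt (abs_nonneg r),
      abs_real_smul, abs_real_smul, abs_abs]
    exact smul_le_smul_of_nonneg_left (hz.trans (le_abs_self _)) (abs_nonneg r)

/-- The topology `τ_F` on the Fremlin tensor product of two locally convex-solid vector lattices. -/
instance topology : TopologicalSpace (FremlinTensorProduct E F) := (filterBasis E F).topology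

end FremlinTensorProduct

end Topology

/-! ### The universal property of the Fremlin tensor product -/

section UniversalProperty

variable {E : Type u} {F : Type v} {G : Type w}
  [AddCommGroup E] [Module ℝ E] [Lattice E]
  [AddCommGroup F] [Module ℝ F] [Lattice F]
  [AddCommGroup G] [Module ℝ G] [Lattice G]

/-! Existence and uniqueness are algebraic. A lattice bimorphism `Φ` into an Archimedean `G` gives
every formal expression a value in `G`, and each defining relation of the tensor product is a law
that holds in `G` (`FremlinRel.eval_eq`). Evaluation therefore descends to the quotient as a lattice
homomorphism `lift`. Since each class is represented by an expression in elementary tensors, no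
other lattice homomorphism takes the same values on them (`hom_ext`).

Continuity rests on the shape of the basic neighbourhoods. If `W` is convex and solid and `T` is a
lattice homomorphism, then `T ⁻¹' W` is convex, balanced and solid. It thus contains `nhdSet U V` as
soon as it contains the tensors `x ⊗ y` with `x ∈ U`, `y ∈ V` (`nhdSet_subset_preimage`), and
continuity of the bimorphism at the origin supplies such `U` and `V`. -/

/-- The value of a formal expression when `x ⊗ y` is interpreted as `Φ x y`. -/
def FremlinTerm.eval (Φ : E →ₗ[ℝ] F →ₗ[ℝ] G) : FremlinTerm E F → G
  | .tmul x y => Φ x y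
  | .zero => 0
  | .add a b => a.eval Φ + b.eval Φ
  | .smul r a => r • a.eval Φ
  | .sup a b => a.eval Φ ⊔ b.eval Φ

namespace FremlinTensorProduct

/-- Lattice homomorphisms on the Fremlin tensor product are determined by their values on
elementary tensors. -/
theorem hom_ext {S T : FremlinTensorProduct E F →ₗ[ℝ] G} (hS : IsLatticeHom S)
    (hT : IsLatticeHom T) (h : ∀ x y, S (tmul E F x y) = T (tmul E F x y)) : S = T := by
  ext z
  induction z using ind with | _ t
  induction t with
  | tmul x y => exact h x y
  | zero => rw [mk_zero, map_zero, map_zero]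
  | add a b ha hb => rw [mk_add, map_add, map_add, ha, hb]
  | smul r a ha => rw [mk_smul, map_smul, map_smul, ha]
  | sup a b ha hb => rw [mk_sup, hS.map_sup, hT.map_sup, ha, hb]

end FremlinTensorProduct

variable [IsOrderedModule ℝ G]

/-- For `r > 0`, scaling by `r` and by `r⁻¹` are mutually inverse monotone maps, and order
isomorphisms preserve suprema. This is what validates the relation `smul_sup` in `G`. -/
theorem smul_sup_of_nonneg {r : ℝ} (hr : 0 ≤ r) (a b : G) : r • (a ⊔ b) = r • a ⊔ r • b := by
  rcases hr.eq_or_lt with rfl | hr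
  · simp
  refine le_antisymm ?_ (sup_le (smul_le_smul_of_nonneg_left le_sup_left hr.le)
    (smul_le_smul_of_nonneg_left le_sup_right hr.le))
  have key : a ⊔ b ≤ r⁻¹ • (r • a ⊔ r • b) := by
    refine sup_le ?_ ?_
    · simpa only [inv_smul_smul₀ hr.ne'] using
        smul_le_smul_of_nonneg_left (le_sup_left (a := r • a) (b := r • b)) (inv_pos.mpr hr).le
    · simpa only [inv_smul_smul₀ hr.ne'] using
        smul_le_smul_of_nonneg_left (le_sup_right (a := r • a) (b := r • b)) (inv_pos.mpr hr).le
  simpa only [smul_inv_smul₀ hr.ne'] using smul_le_smul_of_nonneg_left key hr.le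

variable [IsOrderedAddMonoid G]

/-- The relations of the Fremlin tensor product hold in every Archimedean vector lattice, for
every lattice bimorphism. -/
theorem FremlinRel.eval_eq (hG : IsArchimedeanLattice G) {Φ : E →ₗ[ℝ] F →ₗ[ℝ] G}
    (hΦ : IsLatticeBimorphism Φ) {a b : FremlinTerm E F} (h : FremlinRel E F a b) :
    a.eval Φ = b.eval Φ := by
  induction h with
  | refl => rfl
  | symm _ ih => exact ih.symm
  | trans _ _ ih ih' => exact ih.trans ih'
  | add_congr _ _ ih ih' => exact congrArg₂ (· + ·) ih ih'
  | smul_congr r _ ih => exact congrArg (r • ·) ih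
  | sup_congr _ _ ih ih' => exact congrArg₂ (· ⊔ ·) ih ih'
  | add_comm => exact _root_.add_comm _ _
  | add_assoc => exact _root_.add_assoc _ _ _
  | zero_add => exact _root_.zero_add _
  | smul_add => exact _root_.smul_add _ _ _
  | add_smul => exact _root_.add_smul _ _ _
  | mul_smul => exact SemigroupAction.mul_smul _ _ _
  | one_smul => exact _root_.one_smul ℝ _
  | zero_smul => exact _root_.zero_smul ℝ _
  | sup_comm => exact _root_.sup_comm _ _
  | sup_assoc => exact _root_.sup_assoc _ _ _
  | sup_idem => exact _root_.sup_idem _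
  | sup_add => exact _root_.sup_add _ _ _
  | smul_sup r a b hr => exact smul_sup_of_nonneg hr _ _
  | archimedean a b _ ih =>
    -- This rule has infinitely many premises, one for each `n`. Their induction hypotheses together
    -- are the Archimedean hypothesis in `G`, once real scalars `(n : ℝ)` are read as natural
    -- multiples.
    refine sup_eq_right.mpr (hG _ (b.eval Φ) fun n => ?_)
    rw [← Nat.cast_smul_eq_nsmul ℝ]
    exact sup_eq_right.mp (ih n)
  | add_tmul => exact Φ.map_add₂ _ _ _
  | tmul_add x => exact (Φ x).map_add _ _
  | smul_tmul => exact Φ.map_smul₂ _ _ _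
  | tmul_smul r x => exact (Φ x).map_smul _ _
  | sup_tmul x x' y hy => exact (hΦ.right y hy).map_sup _ _
  | tmul_sup x y y' hx => exact (hΦ.left x hx).map_sup _ _

namespace FremlinTensorProduct

/-- The linear map on the Fremlin tensor product induced by a lattice bimorphism. -/
def lift (hG : IsArchimedeanLattice G) {Φ : E →ₗ[ℝ] F →ₗ[ℝ] G} (hΦ : IsLatticeBimorphism Φ) :
    FremlinTensorProduct E F →ₗ[ℝ] G where
  toFun := Quotient.lift (FremlinTerm.eval Φ) fun _ _ h => FremlinRel.eval_eq hG hΦ h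
  map_add' a b := by
    induction a using ind; induction b using ind
    rfl
  map_smul' r a := by
    induction a using ind
    rfl

theorem lift_tmul (hG : IsArchimedeanLattice G) {Φ : E →ₗ[ℝ] F →ₗ[ℝ] G}
    (hΦ : IsLatticeBimorphism Φ) (x : E) (y : F) : lift hG hΦ (tmul E F x y) = Φ x y :=
  rfl

theorem isLatticeHom_lift (hG : IsArchimedeanLattice G) {Φ : E →ₗ[ℝ] F →ₗ[ℝ] G}
    (hΦ : IsLatticeBimorphism Φ) : IsLatticeHom (lift hG hΦ) :=
  -- Infima come for free, by negation. On representatives, suprema are preserved by the very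
  -- definition of `eval`.
  isLatticeHom_of_map_sup fun a b => by
    induction a using ind; induction b using ind
    rfl

end FremlinTensorProduct

end UniversalProperty

/-! ### Continuity with respect to `τ_F` -/

section Continuity

variable {E : Type u} {F : Type v} {G : Type w}
  [AddCommGroup E] [Module ℝ E] [Lattice E]
  [AddCommGroup G] [Module ℝ G] [Lattice G]

theorem IsLatticeHom.map_abs {T : E →ₗ[ℝ] G} (hT : IsLatticeHom T) (a : E) : T |a| = |T a| := by
  rw [abs, hT.map_sup, map_neg, abs]

theorem IsLatticeHom.monotone {T : E →ₗ[ℝ] G} (hT : IsLatticeHom T) : Monotone T := by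
  intro a b h
  rw [← sup_eq_right] at h ⊢
  rw [← hT.map_sup, h]

variable [AddCommGroup F] [Module ℝ F] [Lattice F]
  [IsOrderedAddMonoid G] [IsOrderedModule ℝ G]

/-- For `|r| ≤ 1` one has `|r • w| = |r| • |w| ≤ |w|`. Hence a convex solid set is absolutely
convex, as the hull in `nhdSet` requires. -/
theorem LatticeOrderedAddCommGroup.IsSolid.balanced {W : Set G}
    (hW : LatticeOrderedAddCommGroup.IsSolid W) : Balanced ℝ W := by
  rintro r hr _ ⟨w, hw, rfl⟩
  refine hW hw ?_
  rw [abs_real_smul]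
  exact smul_le_of_le_one_left (abs_nonneg w) hr

namespace FremlinTensorProduct

/-- By minimality of the absolutely convex hull, it is enough that the absolutely convex set `T ⁻¹'
W` contains the solid hull of the tensors. -/
theorem nhdSet_subset_preimage {T : FremlinTensorProduct E F →ₗ[ℝ] G} (hT : IsLatticeHom T)
    {U : Set E} {V : Set F} {W : Set G} (hc : Convex ℝ W)
    (hs : LatticeOrderedAddCommGroup.IsSolid W)
    (h : ∀ x ∈ U, ∀ y ∈ V, T (tmul E F x y) ∈ W) : nhdSet U V ⊆ T ⁻¹' W := by
  refine absConvexHull_min ?_ ⟨?_, hc.linear_preimage T⟩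
  · rintro z ⟨_, ⟨x, hx, y, hy, rfl⟩, hz⟩
    refine hs (h x hx y hy) ?_
    -- Domination passes through `T`: `|T z| = T |z| ≤ T |x ⊗ y| = |T (x ⊗ y)|`.
    rw [← hT.map_abs, ← hT.map_abs]
    exact hT.monotone hz
  · rintro r hr _ ⟨z, hz, rfl⟩
    rw [mem_preimage, map_smul]
    exact hs.balanced.smul_mem hr hz

variable [IsOrderedAddMonoid E] [IsOrderedModule ℝ E] [IsOrderedAddMonoid F] [IsOrderedModule ℝ F]
  [TopologicalSpace E] [LocallyConvexSolid E] [TopologicalSpace F] [LocallyConvexSolid F]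
  [TopologicalSpace G] [LocallyConvexSolid G]

/-- A lattice homomorphism on the Fremlin tensor product is `τ_F`-continuous as soon as the
associated bimorphism is continuous. -/
theorem continuous_of_continuous_tmul {T : FremlinTensorProduct E F →ₗ[ℝ] G}
    (hT : IsLatticeHom T) (h : Continuous fun p : E × F => T (tmul E F p.1 p.2)) :
    Continuous T := by
  -- With addition continuous for `τ_F`, continuity of the additive map `T` need only be checked at
  -- zero.
  have : IsTopologicalAddGroup (FremlinTensorProduct E F) := (filterBasis E F).isTopologicalAddGroup
  refine continuous_of_continuousAt_zero T ?_
  rw [ContinuousAt, map_zero]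
  intro s hs
  obtain ⟨W, hW, cW, sW, hWs⟩ := LocallyConvexSolid.exists_convex_solid s hs
  have hpre : (fun p : E × F => T (tmul E F p.1 p.2)) ⁻¹' W ∈ 𝓝 ((0 : E), (0 : F)) :=
    h.continuousAt.preimage_mem_nhds (by simpa using hW)
  rw [nhds_prod_eq, mem_prod_iff] at hpre
  obtain ⟨U₀, hU₀, V₀, hV₀, hUV⟩ := hpre
  -- The basic neighbourhoods of `τ_F` are indexed by convex solid sets only, so both factors are
  -- shrunk to such sets.
  obtain ⟨U, hU, cU, sU, hUU₀⟩ := LocallyConvexSolid.exists_convex_solid U₀ hU₀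
  obtain ⟨V, hV, cV, sV, hVV₀⟩ := LocallyConvexSolid.exists_convex_solid V₀ hV₀
  have hnhd : nhdSet U V ∈ 𝓝 (0 : FremlinTensorProduct E F) :=
    (filterBasis E F).toAddGroupFilterBasis.mem_nhds_zero
      ⟨U, hU, V, hV, cU, sU, cV, sV, rfl⟩
  exact mem_map.mpr <| mem_of_superset hnhd <| (nhdSet_subset_preimage hT cW sW fun x hx y hy =>
    hUV (mk_mem_prod (hUU₀ hx) (hVV₀ hy))).trans (preimage_mono hWs)

end FremlinTensorProduct

end Continuity

theorem mainTheorem3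
    {E : Type u} [AddCommGroup E] [Module ℝ E] [Lattice E] [IsOrderedAddMonoid E]
    [IsOrderedModule ℝ E] [TopologicalSpace E] [LocallyConvexSolid E]
    {F : Type v} [AddCommGroup F] [Module ℝ F] [Lattice F] [IsOrderedAddMonoid F]
    [IsOrderedModule ℝ F] [TopologicalSpace F] [LocallyConvexSolid F]
    (hE : IsArchimedeanLattice E) (hF : IsArchimedeanLattice F)
    {G : Type w} [AddCommGroup G] [Module ℝ G] [Lattice G] [IsOrderedAddMonoid G]
    [IsOrderedModule ℝ G] [TopologicalSpace G] [LocallyConvexSolid G]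
    (hG : IsArchimedeanLattice G)
    (Φ : E →ₗ[ℝ] F →ₗ[ℝ] G) (hΦ : IsLatticeBimorphism Φ)
    (hΦc : Continuous fun p : E × F => Φ p.1 p.2) :
    ∃! T : FremlinTensorProduct E F →ₗ[ℝ] G,
      IsLatticeHom T ∧ Continuous T ∧
        ∀ (x : E) (y : F), Φ x y = T (FremlinTensorProduct.tmul E F x y) :=
  have hT := FremlinTensorProduct.isLatticeHom_lift hG hΦ
  ⟨FremlinTensorProduct.lift hG hΦ,
    ⟨hT, FremlinTensorProduct.continuous_of_continuous_tmul hT hΦc,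
      fun x y => (FremlinTensorProduct.lift_tmul hG hΦ x y).symm⟩,
    -- Uniqueness already holds among all lattice homomorphisms with the prescribed values on
    -- elementary tensors.
    fun _ hS => FremlinTensorProduct.hom_ext hS.1 hT fun x y => (hS.2.2 x y).symm⟩
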